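/- Let the Bernoulli numbers $B_m \in \mathbb{Q}$, $m \ge 0$, be defined by $\frac{t}{e^t-1}=\sum_{m=0}^{\infty} B_m \frac{t^m}{m!}$. For a sequence $(c_k)_{k\ge 0}$ of numbers and an integer $n\ge 0$, let $H_n(c_k)=\det_{0\le i,j\le n}\big(c_{i+j}\big)$ denote its $n$th Hankel determinant, the determinant of the $(n+1)\times(n+1)$ matrix with entries $c_{i+j}$. Then for all integers $n\ge 0$, $$H_n\big((2^{2k+2}-1)B_{2k+2}\big)=\frac{(n+1)!}{2^{n+1}}\prod_{\ell=1}^{n}\ell!^4 ,$$ where $\ell!^4=(\ell!)^4$ and the empty product (for $n=0$) equals $1$. -/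

import Mathlib

/-- The `n`th Hankel determinant of the sequence `c 0, c 1, …`: the determinant of the
`(n + 1) × (n + 1)` matrix with entries `c (i + j)`, for `0 ≤ i, j ≤ n`. -/
def hankelDet {R : Type*} [CommRing R] (c : ℕ → R) (n : ℕ) : R :=
  Matrix.det (Matrix.of fun i j : Fin (n + 1) => c ((i : ℕ) + (j : ℕ)))

open Polynomial hiding bernoulli
open Matrix

/-! The functional N with moments (2^m - 1) B_m satisfies N(f(x+1) + f(x)) = -f'(0), because its
exponential generating function is -t/(e^t + 1). The entries are moments of L(f) = N(x^2 f(x^2)). In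
two different monic bases, with roots 1^2, 2^2, … and 0^2, 1^2, …, the Gram matrix of L is (i+j)! up
to row and column factors, and det (i+j)! reduces to a Vandermonde determinant. -/

/-- Replacing the monomials by two sequences of monic polynomials `p i`, `q i` of degree `i`
does not change the determinant of the moments of a linear functional. -/
theorem hankelDet_eq_det_of_monic {R : Type*} [CommRing R] (L : R[X] →ₗ[R] R) (p q : ℕ → R[X])
    (hp : ∀ i, (p i).natDegree = i) (hpm : ∀ i, (p i).Monic)
    (hq : ∀ i, (q i).natDegree = i) (hqm : ∀ i, (q i).Monic) (n : ℕ) :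
    hankelDet (fun k => L (X ^ k)) n =
      det (of fun i j : Fin (n + 1) => L (p i * q j)) := by
  set P : Matrix (Fin (n + 1)) (Fin (n + 1)) R := of fun i j => (p j).coeff i with hP
  set Q : Matrix (Fin (n + 1)) (Fin (n + 1)) R := of fun i j => (q j).coeff i with hQ
  have hPdet : P.det = 1 := det_matrixOfPolynomials (fun i : Fin (n + 1) => p i)
    (fun i => hp i) (fun i => hpm i)
  have hQdet : Q.det = 1 := det_matrixOfPolynomials (fun i : Fin (n + 1) => q i)
    (fun i => hq i) (fun i => hqm i)
  have expand_sum : ∀ f : R[X], f.natDegree < n + 1 →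
      f = ∑ a : Fin (n + 1), C (f.coeff a) * X ^ (a : ℕ) := fun f hf => by
    rw [Fin.sum_univ_eq_sum_range (fun a => C (f.coeff a) * X ^ a)]
    exact f.as_sum_range_C_mul_X_pow' hf
  have key : (of fun i j : Fin (n + 1) => L (p i * q j)) =
      Pᵀ * (of fun i j : Fin (n + 1) => L (X ^ ((i : ℕ) + (j : ℕ)))) * Q := by
    ext i j
    rw [of_apply, expand_sum (p i) (by rw [hp]; exact i.2),
      expand_sum (q j) (by rw [hq]; exact j.2), Finset.sum_mul_sum, map_sum]
    simp only [map_sum, mul_apply, transpose_apply, hP, hQ, of_apply, Finset.sum_mul]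
    rw [Finset.sum_comm]
    refine Finset.sum_congr rfl fun b _ => Finset.sum_congr rfl fun a _ => ?_
    rw [show C ((p i).coeff a) * X ^ (a : ℕ) * (C ((q j).coeff b) * X ^ (b : ℕ)) =
      ((p i).coeff a * (q j).coeff b) • (X ^ ((a : ℕ) + (b : ℕ)) : R[X]) by
        rw [smul_eq_C_mul, C_mul, pow_add]; ring, map_smul, smul_eq_mul]
    ring
  rw [key, det_mul, det_mul, det_transpose, hPdet, hQdet, one_mul, mul_one]
  rfl

/-- Divided by i!, row i lists the rising factorials (i+1)(i+2)⋯(i+j), monic of degree j in i: a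
Vandermonde determinant. -/
theorem det_factorial_add (n : ℕ) :
    det (of fun i j : Fin (n + 1) => (Nat.factorial ((i : ℕ) + (j : ℕ)) : ℚ)) =
      ∏ i : Fin (n + 1), (Nat.factorial i : ℚ) ^ 2 := by
  have h1 : (of fun i j : Fin (n + 1) => (Nat.factorial ((i : ℕ) + (j : ℕ)) : ℚ)) =
      of fun i j : Fin (n + 1) => (Nat.factorial i : ℚ) *
        (of fun i j : Fin (n + 1) => (ascPochhammer ℚ j).eval (((i : ℕ) : ℚ) + 1)) i j := by
    ext i j
    have := ascPochhammer_nat_eq_ascFactorial ((i : ℕ) + 1) j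
    have h2 := Nat.factorial_mul_ascFactorial (i : ℕ) j
    rw [← this] at h2
    simp only [of_apply]
    rw [← h2, Nat.cast_mul, ascPochhammer_eval_cast]
    push_cast
    rfl
  have hdeg : ∀ i : Fin (n + 1), (ascPochhammer ℚ i).natDegree = i :=
    fun i => ascPochhammer_natDegree (S := ℚ) i
  rw [h1, det_mul_column, ← det_eval_matrixOfPolynomials_eq_det_vandermonde
    (fun i : Fin (n + 1) => ((i : ℕ) : ℚ) + 1) _ hdeg (fun i => monic_ascPochhammer ℚ i),
    det_vandermonde_add, det_vandermonde_id_eq_superFactorial,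
    ← Nat.prod_range_factorial_succ]
  rw [Finset.prod_pow, sq, Fin.prod_univ_eq_prod_range (fun i => (Nat.factorial i : ℚ)),
    Nat.cast_prod]
  congr 1
  rw [Finset.prod_range_succ']
  simp

/-- The linear functional on `ℚ[X]` with moments `(2 ^ m - 1) * B_m`. -/
noncomputable def genocchiFunctional : ℚ[X] →ₗ[ℚ] ℚ :=
  Polynomial.lsum fun m => LinearMap.mulRight ℚ (((2 : ℚ) ^ m - 1) * bernoulli m)

theorem genocchiFunctional_X_pow (m : ℕ) :
    genocchiFunctional (X ^ m) = ((2 : ℚ) ^ m - 1) * bernoulli m := by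
  simp [genocchiFunctional, ← monomial_one_right_eq_X_pow, Polynomial.sum_monomial_index]

/-- The series is 2t/(e^{2t} - 1) - t/(e^t - 1), and e^{2t} - 1 = (e^t - 1)(e^t + 1). -/
theorem genocchi_powerSeries_mul :
    (PowerSeries.mk fun m => ((2 : ℚ) ^ m - 1) * bernoulli m / Nat.factorial m) *
      (PowerSeries.exp ℚ + 1) = -PowerSeries.X := by
  set E := PowerSeries.exp ℚ with hE
  set B := bernoulliPowerSeries ℚ with hB
  have hG : (PowerSeries.mk fun m => ((2 : ℚ) ^ m - 1) * bernoulli m / Nat.factorial m) =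
      PowerSeries.rescale 2 B - B := by
    ext m
    simp [hB, bernoulliPowerSeries, PowerSeries.coeff_rescale]
    ring
  have h1 : B * (E - 1) = PowerSeries.X := bernoulliPowerSeries_mul_exp_sub_one ℚ
  have h2 : PowerSeries.rescale 2 B * (E ^ 2 - 1) = 2 * PowerSeries.X := by
    have := congrArg (PowerSeries.rescale (2 : ℚ)) h1
    rw [map_mul, map_sub, map_one, PowerSeries.rescale_X] at this
    rw [hE, PowerSeries.exp_pow_eq_rescale_exp]
    rwa [map_ofNat PowerSeries.C 2] at this
  have hne : E - 1 ≠ 0 := fun h => by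
    rw [h, mul_zero] at h1
    exact PowerSeries.X_ne_zero h1.symm
  rw [hG]
  refine mul_right_cancel₀ hne ?_
  linear_combination h2 - (E + 1) * h1

theorem genocchiFunctional_shift_X_pow (n : ℕ) :
    genocchiFunctional ((X + 1) ^ n) + genocchiFunctional (X ^ n) = if n = 1 then -1 else 0 := by
  have h := congrArg (PowerSeries.coeff n) genocchi_powerSeries_mul
  rw [mul_add, mul_one, map_add, PowerSeries.coeff_mul, PowerSeries.coeff_mk, map_neg,
    PowerSeries.coeff_X,
    Finset.Nat.sum_antidiagonal_eq_sum_range_succ_mk] at h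
  have hn : (Nat.factorial n : ℚ) ≠ 0 := Nat.cast_ne_zero.mpr n.factorial_ne_zero
  have e : genocchiFunctional ((X + 1) ^ n) = Nat.factorial n *
      ∑ k ∈ Finset.range n.succ,
        (PowerSeries.coeff k) (PowerSeries.mk fun m =>
          ((2 : ℚ) ^ m - 1) * bernoulli m / Nat.factorial m) *
        (PowerSeries.coeff (n - k)) (PowerSeries.exp ℚ) := by
    rw [add_pow, map_sum, Finset.mul_sum]
    refine Finset.sum_congr rfl fun k hk => ?_
    have hk : k ≤ n := Nat.lt_succ_iff.mp (Finset.mem_range.mp hk)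
    rw [show (X : ℚ[X]) ^ k * 1 ^ (n - k) * (n.choose k : ℚ[X]) = (n.choose k : ℚ) • X ^ k by
      rw [smul_eq_C_mul, one_pow, mul_one, mul_comm]; simp, map_smul, genocchiFunctional_X_pow,
      Nat.cast_choose ℚ hk]
    simp only [PowerSeries.coeff_mk, PowerSeries.coeff_exp, smul_eq_mul]
    simp
    ring
  rw [e, genocchiFunctional_X_pow]
  have h' := congrArg (fun x => (Nat.factorial n : ℚ) * x) h
  simp only [mul_add] at h'
  rw [mul_div_cancel₀ _ hn] at h'
  rw [h']
  split_ifs with h1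
  · simp [h1]
  · simp

theorem genocchiFunctional_shift (p : ℚ[X]) :
    genocchiFunctional (p.comp (X + 1) + p) = -(derivative p).eval 0 := by
  induction p using Polynomial.induction_on' with
  | add p q hp hq =>
    rw [add_comp, add_add_add_comm, map_add, hp, hq, derivative_add, eval_add, neg_add]
  | monomial n a =>
    rw [← C_mul_X_pow_eq_monomial, mul_comp, C_comp, pow_comp, X_comp, ← mul_add,
      ← smul_eq_C_mul, map_smul, map_add, genocchiFunctional_shift_X_pow]
    rcases n with _ | _ | n <;> simp

/-- The functional `f ↦ N (X ^ 2 * f (X ^ 2))`, with `N = genocchiFunctional`. -/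
noncomputable def evenGenocchiFunctional : ℚ[X] →ₗ[ℚ] ℚ :=
  genocchiFunctional ∘ₗ LinearMap.mulLeft ℚ (X ^ 2) ∘ₗ (expand ℚ 2).toLinearMap

theorem evenGenocchiFunctional_apply (f : ℚ[X]) :
    evenGenocchiFunctional f = genocchiFunctional (X ^ 2 * expand ℚ 2 f) := rfl

theorem evenGenocchiFunctional_X_pow (k : ℕ) : evenGenocchiFunctional (X ^ k) =
    ((2 : ℚ) ^ (2 * k + 2) - 1) * bernoulli (2 * k + 2) := by
  rw [evenGenocchiFunctional_apply, map_pow, expand_X, ← pow_mul, ← pow_add,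
    genocchiFunctional_X_pow, add_comm 2]

/-- The monic polynomial `∏ (X - j ^ 2)` over the `n` integers `j = a, …, a + n - 1`. -/
noncomputable def squareNodal (a n : ℕ) : ℚ[X] :=
  ∏ j ∈ Finset.range n, (X - C (((a + j : ℕ) : ℚ) ^ 2))

theorem squareNodal_succ (a n : ℕ) :
    squareNodal a (n + 1) = squareNodal a n * (X - C (((a + n : ℕ) : ℚ) ^ 2)) :=
  Finset.prod_range_succ _ _

theorem squareNodal_monic (a n : ℕ) : (squareNodal a n).Monic :=
  monic_prod_of_monic _ _ fun _ _ => monic_X_sub_C _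

theorem squareNodal_natDegree (a n : ℕ) : (squareNodal a n).natDegree = n := by
  rw [squareNodal, natDegree_prod_of_monic _ _ fun _ _ => monic_X_sub_C _]
  simp only [natDegree_X_sub_C, Finset.sum_const, Finset.card_range, smul_eq_mul, mul_one]

/-- With S(x) = ∏_{j=1}^k (x^2 - j^2), x S(x) is the product of x - j over -k ≤ j ≤ k, so the shift
x ↦ x + 1 trades the factor x - k for x + k + 1. -/
theorem expand_squareNodal_shift (k : ℕ) :
    (expand ℚ 2 (squareNodal 1 k)).comp (X + 1) * (X + 1) * (X - C (k : ℚ)) =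
      expand ℚ 2 (squareNodal 1 k) * X * (X + C ((k : ℚ) + 1)) := by
  induction k with
  | zero => simp [squareNodal]; ring
  | succ k ih =>
    rw [squareNodal_succ]
    simp only [map_mul, map_sub, expand_X, expand_C, mul_comp, sub_comp, pow_comp, X_comp, C_comp]
    push_cast
    simp only [map_add, map_one, map_pow] at ih ⊢
    linear_combination (X + C (k : ℚ) + 2) * (X - C (k : ℚ) - 1) * ih

theorem eval_zero_expand_squareNodal (k : ℕ) :
    (expand ℚ 2 (squareNodal 1 k)).eval 0 = (-1) ^ k * (Nat.factorial k : ℚ) ^ 2 := by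
  induction k with
  | zero => simp [squareNodal]
  | succ k ih =>
    rw [squareNodal_succ, map_mul, eval_mul, ih, Nat.factorial_succ]
    simp
    ring

theorem evenGenocchiFunctional_squareNodal (k : ℕ) :
    evenGenocchiFunctional (squareNodal 1 k) =
      (-1) ^ k * (Nat.factorial k * Nat.factorial (k + 1)) / 2 := by
  set S := expand ℚ 2 (squareNodal 1 k) with hS
  -- The factor x - (k+1) becomes x - k under the shift, so f(x+1) = x S (x+k+1) and f(x+1) + f(x) =
  -- 2 x^2 S.
  have h := genocchiFunctional_shift (S * X * (X - C ((k : ℚ) + 1)))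
  have e : (S * X * (X - C ((k : ℚ) + 1))).comp (X + 1) + S * X * (X - C ((k : ℚ) + 1)) =
      (2 : ℚ) • (X ^ 2 * S) := by
    have := expand_squareNodal_shift k
    rw [← hS] at this
    simp only [mul_comp, sub_comp, X_comp, C_comp, smul_eq_C_mul]
    simp only [map_add, map_one, map_ofNat] at this ⊢
    linear_combination this
  rw [e, map_smul, ← evenGenocchiFunctional_apply] at h
  have hd : (derivative (S * X * (X - C ((k : ℚ) + 1)))).eval 0 =
      -(S.eval 0 * ((k : ℚ) + 1)) := by
    simp [derivative_mul]
    ring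
  rw [hd, hS, eval_zero_expand_squareNodal, smul_eq_mul] at h
  rw [Nat.factorial_succ]
  push_cast
  linear_combination h / 2

theorem evenGenocchiFunctional_squareNodal_mul (i j : ℕ) :
    evenGenocchiFunctional (squareNodal 1 i * squareNodal 0 j) =
      (-1) ^ (i + j) *
        (Nat.factorial (i + j) * Nat.factorial (i + 1) * Nat.factorial j) / 2 := by
  induction j generalizing i with
  | zero =>
    rw [show squareNodal 0 0 = 1 from rfl, mul_one, evenGenocchiFunctional_squareNodal]
    simp
  | succ j ih =>
    -- Writing x - j^2 = (x - (i+1)^2) + ((i+1)^2 - j^2) moves the last factor of the second product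
    -- to the first.
    have e : squareNodal 1 i * squareNodal 0 (j + 1) =
        squareNodal 1 (i + 1) * squareNodal 0 j +
          (((i : ℚ) + 1) ^ 2 - (j : ℚ) ^ 2) • (squareNodal 1 i * squareNodal 0 j) := by
      rw [squareNodal_succ, squareNodal_succ, smul_eq_C_mul]
      push_cast
      simp only [map_add, map_sub, map_pow, map_one, zero_add]
      ring
    rw [e, map_add, map_smul, ih, ih, smul_eq_mul, show i + 1 + j = i + j + 1 by ring,
      show i + (j + 1) = i + j + 1 by ring, Nat.factorial_succ (i + 1),
      Nat.factorial_succ (i + j), Nat.factorial_succ j]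
    push_cast
    ring

theorem corollary5p3 (n : ℕ) :
    hankelDet (fun k : ℕ => ((2 : ℚ) ^ (2 * k + 2) - 1) * bernoulli (2 * k + 2)) n =
      (Nat.factorial (n + 1) : ℚ) / 2 ^ (n + 1) * ∏ l ∈ Finset.Icc 1 n, (Nat.factorial l : ℚ) ^ 4 := by
  simp_rw [← evenGenocchiFunctional_X_pow]
  rw [hankelDet_eq_det_of_monic evenGenocchiFunctional (squareNodal 1) (squareNodal 0)
    (squareNodal_natDegree 1) (squareNodal_monic 1) (squareNodal_natDegree 0)
    (squareNodal_monic 0)]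
  have e : (of fun i j : Fin (n + 1) =>
      evenGenocchiFunctional (squareNodal 1 i * squareNodal 0 j)) =
      of fun i j : Fin (n + 1) => ((-1) ^ (i : ℕ) * Nat.factorial ((i : ℕ) + 1) / 2 : ℚ) *
        (of fun i j : Fin (n + 1) => ((-1) ^ (j : ℕ) * Nat.factorial j : ℚ) *
          (of fun i j : Fin (n + 1) => (Nat.factorial ((i : ℕ) + (j : ℕ)) : ℚ)) i j) i j := by
    ext i j
    simp only [of_apply, evenGenocchiFunctional_squareNodal_mul]
    ring
  rw [e, det_mul_column, det_mul_row, det_factorial_add, ← Finset.prod_mul_distrib,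
    ← Finset.prod_mul_distrib, Fin.prod_univ_eq_prod_range (fun i : ℕ =>
      ((-1) ^ i * Nat.factorial (i + 1) / 2 : ℚ) *
        (((-1) ^ i * Nat.factorial i : ℚ) * (Nat.factorial i : ℚ) ^ 2))]
  clear e
  induction n with
  | zero => simp
  | succ n ih =>
    rw [Finset.prod_range_succ, ih, Finset.prod_Icc_succ_top (by omega), Nat.factorial_succ (n + 1)]
    have hs : ((-1 : ℚ) ^ (n + 1)) ^ 2 = 1 := by rw [← pow_mul, mul_comm, pow_mul]; simp
    push_cast
    field_simp
    linear_combination (2 : ℚ) ^ (n + 2) * hs
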